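/- Let $n\ge 1$ and $R>0$. Let $X_R$ be uniformly distributed on the sphere $\{x\in\mathbb{R}^n:\|x\|=R\}$, with law $P_{X_R}$, and let $Z\sim\mathcal N(0,I_n)$ be independent of $X_R$. For $0\le\gamma\le 1$ put $Y_\gamma=\sqrt{\gamma}\,X_R+Z$. For $x\in\mathbb{R}^n$ define $$ i(x,P_{X_R})=\int_{\mathbb{R}^n}\frac{1}{(2\pi)^{n/2}}e^{-\|y-x\|^2/2}\,\log\frac{1}{f_Y(y)}\,dy-h(Z), $$ where $\log$ is the natural logarithm, $f_Y(y)=\mathbb{E}\big[(2\pi)^{-n/2}e^{-\|y-X_R\|^2/2}\big]$ is the density of $Y=X_R+Z$, and $h(Z)$ is the differential entropy of $Z$. Then all integrals below and in the definition of $i(x,P_{X_R})$, for $\|x\|=R$ and for $x=0$, converge absolutely. For every $x$ with $\|x\|=R$, $$ i(x,P_{X_R})=\frac12\int_0^1\mathbb{E}\Big[\big\|X_R-\mathbb{E}[X_R\mid Y_\gamma]\big\|^2\,\Big|\,\|X_R\|=R\Big]\,d\gamma, $$ and $$ i(0,P_{X_R})=\frac12\int_0^1\mathbb{E}\Big[\big\|X_R-\mathbb{E}[X_R\mid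 Y_\gamma]\big\|^2\,\Big|\,\|X_R\|=0\Big]\,d\gamma. $$ Here the conditional expectation given the null event $\|X_R\|=0$, i.e. $X_R=0$, is taken through the channel: given $X_R=x$, the output $Y_\gamma$ has law $\mathcal N(\sqrt\gamma\,x,I_n)$, so that the integrand is $\int\|0-\mathbb{E}[X_R\mid Y_\gamma=y]\|^2\,(2\pi)^{-n/2}e^{-\|y\|^2/2}\,dy$, where $y\mapsto\mathbb{E}[X_R\mid Y_\gamma=y]$ is the conditional mean under the original law $X_R\sim P_{X_R}$ (any version gives the same value). -/

import Mathlib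

open MeasureTheory ProbabilityTheory

/-- The uniform distribution on the sphere `{x | ‖x‖ = R}` of `ℝⁿ`: the surface measure of the
unit sphere, normalized to total mass one and transported by `u ↦ R u`. For `n = 1` this is the
uniform distribution on `{-R, R}`. -/
noncomputable def sphereUniform (n : ℕ) (R : ℝ) : Measure (EuclideanSpace ℝ (Fin n)) :=
  (((volume : Measure (EuclideanSpace ℝ (Fin n))).toSphere Set.univ)⁻¹ •
    (volume : Measure (EuclideanSpace ℝ (Fin n))).toSphere).map
      (fun u : Metric.sphere (0 : EuclideanSpace ℝ (Fin n)) 1 => R • (u : EuclideanSpace ℝ (Fin n)))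

/-- The density of the standard Gaussian noise `Z ∼ N(0, Iₙ)`. -/
noncomputable def noiseDensity {n : ℕ} (z : EuclideanSpace ℝ (Fin n)) : ℝ :=
  (2 * Real.pi) ^ (-(n : ℝ) / 2) * Real.exp (-‖z‖ ^ 2 / 2)

/-- The differential entropy `h(Z)` of the noise, in nats. -/
noncomputable def noiseEntropy (n : ℕ) : ℝ :=
  ∫ z : EuclideanSpace ℝ (Fin n), noiseDensity z * Real.log (1 / noiseDensity z)

/-- The output density `f_Y` of `Y = X + Z` when `X` has law `P`. -/
noncomputable def outputDensity {n : ℕ} (P : Measure (EuclideanSpace ℝ (Fin n)))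
    (y : EuclideanSpace ℝ (Fin n)) : ℝ :=
  ∫ x, noiseDensity (y - x) ∂P

/-- The information density `i(x, P)` of the input law `P` at the point `x`, in nats. -/
noncomputable def infoDensity {n : ℕ} (x : EuclideanSpace ℝ (Fin n))
    (P : Measure (EuclideanSpace ℝ (Fin n))) : ℝ :=
  (∫ y, noiseDensity (y - x) * Real.log (1 / outputDensity P y)) - noiseEntropy n

/-- The output `Y_γ = √γ X + Z` of the channel at signal-to-noise ratio `γ`. -/
noncomputable def snrOutput {n : ℕ} {Ω : Type*} (X Z : Ω → EuclideanSpace ℝ (Fin n)) (γ : ℝ) :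
    Ω → EuclideanSpace ℝ (Fin n) :=
  fun ω => Real.sqrt γ • X ω + Z ω

/-- The function `y ↦ E[X | Y = y]`, the mean of the regular conditional distribution of `X`
given `Y = y`. -/
noncomputable def condMean {n : ℕ} {Ω : Type*} [MeasurableSpace Ω] (μ : Measure Ω)
    [IsFiniteMeasure μ] (X Y : Ω → EuclideanSpace ℝ (Fin n)) (y : EuclideanSpace ℝ (Fin n)) :
    EuclideanSpace ℝ (Fin n) :=
  ∫ x, x ∂(condDistrib X Y μ y)

/-- `condMean μ X Y` evaluated at `Y` is the conditional expectation `E[X | Y]`. -/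
theorem condMean_comp_ae_eq {n : ℕ} {Ω : Type*} [MeasurableSpace Ω] (μ : Measure Ω)
    [IsFiniteMeasure μ] (X Y : Ω → EuclideanSpace ℝ (Fin n)) (hX : Integrable X μ)
    (hY : Measurable Y) :
    μ[X | MeasurableSpace.comap Y inferInstance] =ᵐ[μ] fun ω => condMean μ X Y (Y ω) :=
  condExp_ae_eq_integral_condDistrib hY hX.aemeasurable
    (stronglyMeasurable_id) (by simpa using hX)

/-- The conditional law of `Y_γ = √γ X + Z` given `X = x`, that is, the law `N(√γ x, Iₙ)` of
`√γ x + Z`. -/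
noncomputable def channelLaw {n : ℕ} (γ : ℝ) (x : EuclideanSpace ℝ (Fin n)) :
    Measure (EuclideanSpace ℝ (Fin n)) :=
  (stdGaussian (EuclideanSpace ℝ (Fin n))).map (fun z => Real.sqrt γ • x + z)

/-- The squared estimation error `‖x - E[X | Y_γ = y]‖²` as a function of the input value `x` and
the output value `y`. -/
noncomputable def sqError {n : ℕ} {Ω : Type*} [MeasurableSpace Ω] (μ : Measure Ω)
    [IsFiniteMeasure μ] (X Z : Ω → EuclideanSpace ℝ (Fin n)) (γ : ℝ)
    (x y : EuclideanSpace ℝ (Fin n)) : ℝ :=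
  ‖x - condMean μ X (snrOutput X Z γ) y‖ ^ 2

/-- `E[‖X - E[X | Y_γ]‖² | ‖X‖ = r]`, for an event `{‖X‖ = r}` of positive probability. -/
noncomputable def condMSEOfNormEq {n : ℕ} {Ω : Type*} [MeasurableSpace Ω] (μ : Measure Ω)
    [IsFiniteMeasure μ] (X Z : Ω → EuclideanSpace ℝ (Fin n)) (r γ : ℝ) : ℝ :=
  ∫ ω, sqError μ X Z γ (X ω) (snrOutput X Z γ ω) ∂(μ[|{ω | ‖X ω‖ = r}])

/-- `E[‖X - E[X | Y_γ]‖² | X = x]`, computed from the conditional law of `Y_γ` given `X = x`; it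
makes sense also for `x` outside the support of `X`. The choice of the version of
`y ↦ E[X | Y_γ = y]` has no influence, since `channelLaw γ x` and the law of `Y_γ` have
the same null sets. -/
noncomputable def condMSEOfEq {n : ℕ} {Ω : Type*} [MeasurableSpace Ω] (μ : Measure Ω)
    [IsFiniteMeasure μ] (X Z : Ω → EuclideanSpace ℝ (Fin n)) (x : EuclideanSpace ℝ (Fin n))
    (γ : ℝ) : ℝ :=
  ∫ y, sqError μ X Z γ x y ∂(channelLaw γ x)

/-! Write `P` for the input law, G(v) = ∫ exp⟪v, x⟫ dP (`expMoment`) and m = ∇ log G (`tiltedMean`).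
Since the norm is constant on the support, f_Y(y) = φ(y) exp(-R²/2) G(y) with φ the noise density,
so that i(x, P) = (‖x‖² + R²)/2 - E log G(x + Z) (`infoDensity_eq`). For the same reason Bayes' rule
gives E[X | Y_γ = y] = m(√γ y) (`condMean_snrOutput_ae_eq`).

Interpolate with Φ(γ) = E log G(γx + √γ Z), where Φ(0) = 0. Its derivative is E⟪m, x + Z/(2√γ)⟫.
Gaussian integration by parts turns the Z term into half the expected divergence of m. That
divergence is the trace of the covariance of the tilted law, which equals R² - ‖m‖² on a sphere.
Completing the square gives Φ'(γ) = (‖x‖² + R² - E‖x - m‖²)/2 (`hasDerivAt_integral_log_expMoment`).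
Integrating over [0, 1] proves the identity for every x and every law on a sphere
(`infoDensity_eq_integral_tiltedMSE`).

It remains to identify `tiltedMSE` with the two conditional errors. On the sphere, rotation
invariance makes the error at a point equal to its average. At the origin the conditional mean is
needed Lebesgue-almost everywhere, which holds because Lebesgue measure is absolutely continuous
with respect to the law of Y_γ. -/

open scoped RealInnerProductSpace

/-! ### The standard Gaussian measure and its density -/

section Gaussian

variable {n : ℕ}

theorem noiseDensity_pos (z : EuclideanSpace ℝ (Fin n)) : 0 < noiseDensity z := by
  unfold noiseDensity; positivity

@[fun_prop]
theorem continuous_noiseDensity :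
    Continuous (noiseDensity : EuclideanSpace ℝ (Fin n) → ℝ) := by
  unfold noiseDensity; fun_prop

theorem integrable_noiseDensity :
    Integrable (noiseDensity : EuclideanSpace ℝ (Fin n) → ℝ) := by
  have h := GaussianFourier.integrable_cexp_neg_mul_sq_norm_add
    (V := EuclideanSpace ℝ (Fin n)) (b := 1 / 2) (by norm_num) 0 0
  refine (h.norm.const_mul ((2 * Real.pi) ^ (-(n : ℝ) / 2))).congr (.of_forall fun z => ?_)
  simp only [Complex.norm_exp, noiseDensity]
  congr 2
  norm_num [← Complex.ofReal_pow]
  ring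

instance isFiniteMeasure_withDensity_noiseDensity :
    IsFiniteMeasure ((volume : Measure (EuclideanSpace ℝ (Fin n))).withDensity
      fun z => ENNReal.ofReal (noiseDensity z)) :=
  isFiniteMeasure_withDensity_ofReal integrable_noiseDensity.2

/-- Both sides have the same characteristic function, by the explicit Fourier transform of a
Gaussian. -/
theorem stdGaussian_eq_withDensity :
    stdGaussian (EuclideanSpace ℝ (Fin n)) =
      volume.withDensity fun z => ENNReal.ofReal (noiseDensity z) := by
  refine Measure.ext_of_charFun (funext fun t => ?_)
  rw [charFun_stdGaussian, charFun_apply, integral_withDensity_eq_integral_toReal_smul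
    (by fun_prop) (by simp)]
  have h := GaussianFourier.integral_cexp_neg_mul_sq_norm_add
    (V := EuclideanSpace ℝ (Fin n)) (b := 1 / 2) (by norm_num) Complex.I t
  have h2 : ∀ z : EuclideanSpace ℝ (Fin n),
      (ENNReal.ofReal (noiseDensity z)).toReal • Complex.exp (⟪z, t⟫ * Complex.I) =
      ((2 * Real.pi) ^ (-(n : ℝ) / 2) : ℝ) *
        Complex.exp (-(1 / 2) * ‖z‖ ^ 2 + Complex.I * ⟪t, z⟫) := by
    intro z
    rw [ENNReal.toReal_ofReal (noiseDensity_pos z).le, noiseDensity, Complex.exp_add,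
      Complex.real_smul, Complex.ofReal_mul, mul_assoc, Complex.ofReal_exp, real_inner_comm,
      mul_comm Complex.I]
    congr 3
    push_cast
    ring_nf
  simp_rw [h2]
  rw [integral_const_mul, h, finrank_euclideanSpace_fin, ← mul_assoc]
  have h3 : (((2 * Real.pi) ^ (-(n : ℝ) / 2) : ℝ) : ℂ) * (Real.pi / (1 / 2)) ^ ((n : ℂ) / 2) = 1 := by
    rw [Complex.ofReal_cpow (by positivity)]
    push_cast
    rw [show (Real.pi / (1 / 2) : ℂ) = 2 * Real.pi by ring, neg_div, Complex.cpow_neg]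
    refine inv_mul_cancel₀ ?_
    rw [Complex.cpow_ne_zero_iff]
    left
    simp [Real.pi_ne_zero]
  rw [h3, one_mul, Complex.I_sq]
  congr 1
  ring

theorem integral_stdGaussian {F : Type*} [NormedAddCommGroup F] [NormedSpace ℝ F]
    (f : EuclideanSpace ℝ (Fin n) → F) :
    ∫ z, f z ∂stdGaussian (EuclideanSpace ℝ (Fin n)) = ∫ z, noiseDensity z • f z := by
  rw [stdGaussian_eq_withDensity, integral_withDensity_eq_integral_toReal_smul
    (by fun_prop) (by simp)]
  simp_rw [ENNReal.toReal_ofReal (noiseDensity_pos _).le]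

theorem integrable_stdGaussian_iff {F : Type*} [NormedAddCommGroup F] [NormedSpace ℝ F]
    {f : EuclideanSpace ℝ (Fin n) → F} :
    Integrable f (stdGaussian (EuclideanSpace ℝ (Fin n))) ↔
      Integrable (fun z => noiseDensity z • f z) := by
  rw [stdGaussian_eq_withDensity, integrable_withDensity_iff_integrable_smul'
    (by fun_prop) (by simp)]
  simp_rw [ENNReal.toReal_ofReal (noiseDensity_pos _).le]

theorem stdGaussian_absolutelyContinuous :
    stdGaussian (EuclideanSpace ℝ (Fin n)) ≪ volume := by
  rw [stdGaussian_eq_withDensity]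
  exact withDensity_absolutelyContinuous _ _

theorem absolutelyContinuous_stdGaussian :
    volume ≪ stdGaussian (EuclideanSpace ℝ (Fin n)) := by
  rw [stdGaussian_eq_withDensity]
  exact withDensity_absolutelyContinuous' (by fun_prop)
    (.of_forall fun z => by simpa using noiseDensity_pos z)

theorem integrable_norm_stdGaussian :
    Integrable (fun z => ‖z‖) (stdGaussian (EuclideanSpace ℝ (Fin n))) :=
  IsGaussian.integrable_id.norm

theorem integrable_norm_sq_stdGaussian :
    Integrable (fun z => ‖z‖ ^ 2) (stdGaussian (EuclideanSpace ℝ (Fin n))) :=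
  (IsGaussian.memLp_two_id (μ := stdGaussian (EuclideanSpace ℝ (Fin n)))).integrable_norm_pow
    (by norm_num)

end Gaussian

/-! ### The uniform law on a sphere and its rotation invariance -/

section Sphere

variable {n : ℕ} {R : ℝ}

theorem measurable_smul_sphere (R : ℝ) : Measurable
    (fun u : Metric.sphere (0 : EuclideanSpace ℝ (Fin n)) 1 => R • (u : EuclideanSpace ℝ (Fin n))) :=
  by fun_prop

theorem isProbabilityMeasure_sphereUniform (hn : 1 ≤ n) (R : ℝ) :
    IsProbabilityMeasure (sphereUniform n R) := by
  have : Nonempty (Fin n) := ⟨⟨0, hn⟩⟩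
  have : NeZero (volume : Measure (EuclideanSpace ℝ (Fin n))).toSphere := ⟨Measure.toSphere_ne_zero _⟩
  unfold sphereUniform
  exact Measure.isProbabilityMeasure_map (measurable_smul_sphere R).aemeasurable

theorem ae_norm_eq_sphereUniform (hR : 0 ≤ R) : ∀ᵐ x ∂sphereUniform n R, ‖x‖ = R := by
  unfold sphereUniform
  rw [ae_map_iff (measurable_smul_sphere R).aemeasurable
    (measurableSet_eq_fun measurable_norm measurable_const)]
  exact .of_forall fun u => by simp [norm_smul, abs_of_nonneg hR]

-- The surface measure of a set is a multiple of the volume of the cone over it, and a linear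
-- isometry preserves volume and carries cones to cones.
open scoped Pointwise in
theorem map_toSphere (U : EuclideanSpace ℝ (Fin n) ≃ₗᵢ[ℝ] EuclideanSpace ℝ (Fin n))
    (V : Metric.sphere (0 : EuclideanSpace ℝ (Fin n)) 1 → Metric.sphere (0 : EuclideanSpace ℝ (Fin n)) 1)
    (hV : ∀ u, (V u : EuclideanSpace ℝ (Fin n)) = U u) :
    (volume : Measure (EuclideanSpace ℝ (Fin n))).toSphere.map V =
      (volume : Measure (EuclideanSpace ℝ (Fin n))).toSphere := by
  have hVc : Continuous V := by
    rw [continuous_induced_rng]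
    exact (U.continuous.comp continuous_subtype_val).congr fun u => (hV u).symm
  ext s hs
  rw [Measure.map_apply hVc.measurable hs, Measure.toSphere_apply' _ (hVc.measurable hs),
    Measure.toSphere_apply' _ hs]
  congr 1
  conv_rhs => rw [← U.measurePreserving.measure_preimage_equiv (f := U.toMeasurableEquiv)]
  congr 1
  ext z
  simp only [Set.mem_smul, Set.mem_image, Set.mem_preimage, LinearIsometryEquiv.coe_toMeasurableEquiv]
  constructor
  · rintro ⟨r, hr, _, ⟨u, hu, rfl⟩, rfl⟩
    exact ⟨r, hr, _, ⟨V u, hu, rfl⟩, by simp [hV]⟩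
  · rintro ⟨r, hr, _, ⟨u, hu, rfl⟩, h : r • (u : EuclideanSpace ℝ (Fin n)) = U z⟩
    have hmem : U.symm u ∈ Metric.sphere (0 : EuclideanSpace ℝ (Fin n)) 1 := by simp
    have hVu : V ⟨U.symm u, hmem⟩ = u := Subtype.ext (by simp [hV])
    refine ⟨r, hr, _, ⟨⟨U.symm u, hmem⟩, by rwa [hVu], rfl⟩, ?_⟩
    apply U.injective
    rw [← h]
    simp

theorem map_sphereUniform (U : EuclideanSpace ℝ (Fin n) ≃ₗᵢ[ℝ] EuclideanSpace ℝ (Fin n)) (R : ℝ) :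
    (sphereUniform n R).map U = sphereUniform n R := by
  let V : Metric.sphere (0 : EuclideanSpace ℝ (Fin n)) 1 → Metric.sphere (0 : EuclideanSpace ℝ (Fin n)) 1 :=
    fun u => ⟨U u, by simp⟩
  have hVm : Measurable V := (U.continuous.measurable.comp measurable_subtype_coe).subtype_mk
  have hmap := map_toSphere U V fun _ => rfl
  unfold sphereUniform
  rw [Measure.map_map U.continuous.measurable (measurable_smul_sphere R)]
  conv_rhs => rw [← hmap]
  rw [← Measure.map_smul, Measure.map_map (measurable_smul_sphere R) hVm]
  have h1 : (U : EuclideanSpace ℝ (Fin n) → EuclideanSpace ℝ (Fin n)) ∘ (fun u : Metric.sphere (0 : EuclideanSpace ℝ (Fin n)) 1 => R • (u : EuclideanSpace ℝ (Fin n))) = (fun u : Metric.sphere (0 : EuclideanSpace ℝ (Fin n)) 1 => R • (u : EuclideanSpace ℝ (Fin n))) ∘ V := by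
    ext1 u; simp [V]
  rw [h1]
  congr 3
  rw [Measure.map_apply hVm .univ, Set.preimage_univ]

end Sphere

/-! ### Exponential tilting of a law on a sphere -/

section Tilted

variable {n : ℕ}

/-- The moment generating function `v ↦ ∫ exp ⟪v, x⟫ dP`. -/
noncomputable def expMoment (P : Measure (EuclideanSpace ℝ (Fin n)))
    (v : EuclideanSpace ℝ (Fin n)) : ℝ :=
  ∫ x, Real.exp ⟪v, x⟫ ∂P

/-- The mean of the exponentially tilted measure `exp ⟪v, x⟫ dP / ∫ exp ⟪v, x⟫ dP`. -/
noncomputable def tiltedMean (P : Measure (EuclideanSpace ℝ (Fin n)))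
    (v : EuclideanSpace ℝ (Fin n)) : EuclideanSpace ℝ (Fin n) :=
  ∫ x, x ∂(P.tilted fun x => ⟪v, x⟫)

variable {P : Measure (EuclideanSpace ℝ (Fin n))} {R : ℝ}

theorem integrable_exp_inner_smul [IsFiniteMeasure P] (hP : ∀ᵐ x ∂P, ‖x‖ = R)
    {F : Type*} [NormedAddCommGroup F] [NormedSpace ℝ F] {h : EuclideanSpace ℝ (Fin n) → F}
    (hh : Continuous h) {C : ℝ} (hC : ∀ x, ‖x‖ = R → ‖h x‖ ≤ C) (v : EuclideanSpace ℝ (Fin n)) :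
    Integrable (fun x => Real.exp ⟪v, x⟫ • h x) P := by
  refine Integrable.of_bound (by fun_prop) (Real.exp (‖v‖ * R) * C) ?_
  filter_upwards [hP] with x hx
  rw [norm_smul, Real.norm_of_nonneg (Real.exp_pos _).le]
  gcongr
  · exact (real_inner_le_norm v x).trans (by rw [hx])
  · exact hC x hx

theorem integrable_exp_inner [IsFiniteMeasure P] (hP : ∀ᵐ x ∂P, ‖x‖ = R)
    (v : EuclideanSpace ℝ (Fin n)) : Integrable (fun x => Real.exp ⟪v, x⟫) P := by
  simpa using integrable_exp_inner_smul hP (h := fun _ => (1 : ℝ)) (by fun_prop) (C := 1)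
    (by simp) v

/-- Differentiation under the integral sign. The weight `h` is vector-valued so that `h = 1` gives
the derivative of G and `h = id` that of the numerator of the tilted mean. -/
theorem hasFDerivAt_integral_exp_inner_smul [IsFiniteMeasure P] (hP : ∀ᵐ x ∂P, ‖x‖ = R)
    {F : Type*} [NormedAddCommGroup F] [NormedSpace ℝ F] {h : EuclideanSpace ℝ (Fin n) → F}
    (hh : Continuous h) {C : ℝ} (hC : ∀ x, ‖x‖ = R → ‖h x‖ ≤ C) (v : EuclideanSpace ℝ (Fin n)) :
    HasFDerivAt (fun v => ∫ x, Real.exp ⟪v, x⟫ • h x ∂P)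
      (∫ x, Real.exp ⟪v, x⟫ • (innerSL ℝ x).smulRight (h x) ∂P) v := by
  refine hasFDerivAt_integral_of_dominated_of_fderiv_le
    (F' := fun v x => Real.exp ⟪v, x⟫ • (innerSL ℝ x).smulRight (h x))
    -- Every point of the unit ball around `v` has norm at most `‖v‖ + 1`.
    (bound := fun _ => Real.exp ((‖v‖ + 1) * R) * (R * C))
    (Metric.ball_mem_nhds v one_pos) ?_ (integrable_exp_inner_smul hP hh hC v)
    ?_ ?_ (integrable_const _) ?_
  · exact .of_forall fun w => by fun_prop
  · have := secondCountableTopologyEither_of_left (EuclideanSpace ℝ (Fin n))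
      (EuclideanSpace ℝ (Fin n) →L[ℝ] F)
    refine Continuous.aestronglyMeasurable ?_
    have : Continuous fun x => (innerSL ℝ x).smulRight (h x) := by
      exact ((ContinuousLinearMap.smulRightL ℝ (EuclideanSpace ℝ (Fin n)) F).continuous₂.comp
        ((innerSL ℝ).continuous.prodMk hh))
    fun_prop
  · filter_upwards [hP] with x hx w hw
    have hwn : ‖w‖ ≤ ‖v‖ + 1 := by
      have := norm_le_norm_add_norm_sub v w
      rw [Metric.mem_ball, dist_eq_norm, norm_sub_rev] at hw
      linarith
    have hC0 : 0 ≤ C := (norm_nonneg _).trans (hC x hx)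
    have hR0 : 0 ≤ R := hx ▸ norm_nonneg x
    rw [norm_smul, Real.norm_of_nonneg (Real.exp_pos _).le, ContinuousLinearMap.norm_smulRight_apply,
      innerSL_apply_norm, hx]
    gcongr
    · refine (real_inner_le_norm w x).trans ?_
      rw [hx]
      gcongr
    · exact hC x hx
  · refine .of_forall fun x w _ => ?_
    have h1 : HasFDerivAt (fun w : EuclideanSpace ℝ (Fin n) => ⟪w, x⟫) (innerSL ℝ x) w := by
      convert (innerSL ℝ x).hasFDerivAt (x := w) using 1
      ext y; simp [real_inner_comm]
    refine (h1.exp.smul_const (h x)).congr_fderiv ?_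
    ext y
    simp [smul_smul]

theorem expMoment_pos [IsProbabilityMeasure P] (hP : ∀ᵐ x ∂P, ‖x‖ = R)
    (v : EuclideanSpace ℝ (Fin n)) : 0 < expMoment P v :=
  integral_exp_pos (integrable_exp_inner hP v)

theorem integral_tilted_inner {F : Type*} [NormedAddCommGroup F] [NormedSpace ℝ F]
    (h : EuclideanSpace ℝ (Fin n) → F) (v : EuclideanSpace ℝ (Fin n)) :
    ∫ x, h x ∂(P.tilted fun x => ⟪v, x⟫) =
      (expMoment P v)⁻¹ • ∫ x, Real.exp ⟪v, x⟫ • h x ∂P := by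
  rw [integral_tilted, ← integral_smul]
  simp_rw [expMoment, smul_smul, div_eq_inv_mul]

theorem isProbabilityMeasure_tilted_inner [IsProbabilityMeasure P] (hP : ∀ᵐ x ∂P, ‖x‖ = R)
    (v : EuclideanSpace ℝ (Fin n)) : IsProbabilityMeasure (P.tilted fun x => ⟪v, x⟫) :=
  isProbabilityMeasure_tilted (integrable_exp_inner hP v)

theorem ae_norm_eq_tilted_inner (hP : ∀ᵐ x ∂P, ‖x‖ = R)
    (v : EuclideanSpace ℝ (Fin n)) : ∀ᵐ x ∂(P.tilted fun x => ⟪v, x⟫), ‖x‖ = R :=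
  (tilted_absolutelyContinuous P _).ae_le hP

theorem norm_integral_tilted_inner_le [IsProbabilityMeasure P] (hP : ∀ᵐ x ∂P, ‖x‖ = R)
    {F : Type*} [NormedAddCommGroup F] [NormedSpace ℝ F] {h : EuclideanSpace ℝ (Fin n) → F}
    {C : ℝ} (hC : ∀ x, ‖x‖ = R → ‖h x‖ ≤ C) (v : EuclideanSpace ℝ (Fin n)) :
    ‖∫ x, h x ∂(P.tilted fun x => ⟪v, x⟫)‖ ≤ C := by
  have := isProbabilityMeasure_tilted_inner hP v
  simpa using norm_integral_le_of_norm_le_const (μ := P.tilted fun x => ⟪v, x⟫)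
    ((ae_norm_eq_tilted_inner hP v).mono hC)

theorem norm_tiltedMean_le [IsProbabilityMeasure P] (hP : ∀ᵐ x ∂P, ‖x‖ = R)
    (v : EuclideanSpace ℝ (Fin n)) : ‖tiltedMean P v‖ ≤ R :=
  norm_integral_tilted_inner_le hP (fun _ hx => hx.le) v

theorem integrable_tilted_inner [IsProbabilityMeasure P] (hP : ∀ᵐ x ∂P, ‖x‖ = R)
    {F : Type*} [NormedAddCommGroup F] [NormedSpace ℝ F] {h : EuclideanSpace ℝ (Fin n) → F}
    (hh : Continuous h) {C : ℝ} (hC : ∀ x, ‖x‖ = R → ‖h x‖ ≤ C) (v : EuclideanSpace ℝ (Fin n)) :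
    Integrable h (P.tilted fun x => ⟪v, x⟫) := by
  have := isProbabilityMeasure_tilted_inner hP v
  exact Integrable.of_bound hh.aestronglyMeasurable C ((ae_norm_eq_tilted_inner hP v).mono hC)

theorem hasFDerivAt_expMoment [IsProbabilityMeasure P] (hP : ∀ᵐ x ∂P, ‖x‖ = R)
    (v : EuclideanSpace ℝ (Fin n)) :
    HasFDerivAt (expMoment P) (expMoment P v • innerSL ℝ (tiltedMean P v)) v := by
  have h := hasFDerivAt_integral_exp_inner_smul hP (h := fun _ => (1 : ℝ)) (by fun_prop) (C := 1)
    (by simp) v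
  refine (h.congr_of_eventuallyEq (.of_forall fun w => by simp [expMoment])).congr_fderiv ?_
  have hi : Integrable (fun x => Real.exp ⟪v, x⟫ • x) P :=
    integrable_exp_inner_smul hP continuous_id (fun _ hx => hx.le) v
  rw [tiltedMean, integral_tilted_inner, map_smul, smul_smul,
    mul_inv_cancel₀ (expMoment_pos hP v).ne', one_smul,
    ← (innerSL ℝ).integral_comp_comm hi]
  congr 1
  ext x w
  simp
  rfl

theorem hasFDerivAt_log_expMoment [IsProbabilityMeasure P] (hP : ∀ᵐ x ∂P, ‖x‖ = R)
    (v : EuclideanSpace ℝ (Fin n)) :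
    HasFDerivAt (fun v => Real.log (expMoment P v)) (innerSL ℝ (tiltedMean P v)) v := by
  refine ((hasFDerivAt_expMoment hP v).log (expMoment_pos hP v).ne').congr_fderiv ?_
  rw [smul_smul, inv_mul_cancel₀ (expMoment_pos hP v).ne', one_smul]

/-- The product rule for G⁻¹ · ∫ exp⟪v, x⟫ x dP; the derivative is the covariance operator of the
tilted law. -/
theorem hasFDerivAt_tiltedMean [IsProbabilityMeasure P] (hP : ∀ᵐ x ∂P, ‖x‖ = R)
    (v : EuclideanSpace ℝ (Fin n)) :
    HasFDerivAt (tiltedMean P)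
      (∫ x, (innerSL ℝ x).smulRight x ∂(P.tilted fun x => ⟪v, x⟫) -
        (innerSL ℝ (tiltedMean P v)).smulRight (tiltedMean P v)) v := by
  have h := hasFDerivAt_integral_exp_inner_smul hP (h := fun x => x) (by fun_prop) (C := R)
    (fun _ hx => hx.le) v
  have hG := expMoment_pos hP v
  have hinv := (hasDerivAt_inv hG.ne').comp_hasFDerivAt v (hasFDerivAt_expMoment hP v)
  refine ((hinv.smul h).congr_of_eventuallyEq
    (.of_forall fun w => by simp [tiltedMean, integral_tilted_inner])).congr_fderiv ?_
  rw [integral_tilted_inner, sub_eq_add_neg]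
  congr 1
  have h2 : ∫ x, Real.exp ⟪v, x⟫ • x ∂P = expMoment P v • tiltedMean P v := by
    rw [tiltedMean, integral_tilted_inner, smul_smul, mul_inv_cancel₀ hG.ne', one_smul]
  ext1 w
  simp only [h2, ContinuousLinearMap.smulRight_apply, neg_apply,
    smul_apply, smul_smul, ← neg_smul, innerSL_apply_apply]
  congr 1
  simp only [smul_eq_mul]
  field_simp

theorem differentiable_tiltedMean [IsProbabilityMeasure P] (hP : ∀ᵐ x ∂P, ‖x‖ = R) :
    Differentiable ℝ (tiltedMean P) := fun v => (hasFDerivAt_tiltedMean hP v).differentiableAt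

theorem continuous_smulRight_innerSL : Continuous fun x : EuclideanSpace ℝ (Fin n) =>
    (innerSL ℝ x).smulRight x :=
  (ContinuousLinearMap.smulRightL ℝ (EuclideanSpace ℝ (Fin n))
    (EuclideanSpace ℝ (Fin n))).continuous₂.comp ((innerSL ℝ).continuous.prodMk continuous_id)

theorem norm_fderiv_tiltedMean_le [IsProbabilityMeasure P] (hP : ∀ᵐ x ∂P, ‖x‖ = R)
    (v : EuclideanSpace ℝ (Fin n)) : ‖fderiv ℝ (tiltedMean P) v‖ ≤ R * R + R * R := by
  rw [(hasFDerivAt_tiltedMean hP v).fderiv]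
  refine (norm_sub_le _ _).trans (add_le_add ?_ ?_)
  · refine norm_integral_tilted_inner_le hP (fun x hx => ?_) v
    rw [ContinuousLinearMap.norm_smulRight_apply, innerSL_apply_norm, hx]
  · rw [ContinuousLinearMap.norm_smulRight_apply, innerSL_apply_norm]
    have := norm_tiltedMean_le hP v
    exact mul_le_mul this this (norm_nonneg _) ((norm_nonneg _).trans this)

/-- The trace of a covariance is the second moment minus the squared norm of the mean, and tilting
keeps the law on the sphere, where the second moment is `R ^ 2`. -/
theorem sum_inner_fderiv_tiltedMean [IsProbabilityMeasure P] (hP : ∀ᵐ x ∂P, ‖x‖ = R)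
    {ι : Type*} [Fintype ι] (b : OrthonormalBasis ι ℝ (EuclideanSpace ℝ (Fin n)))
    (v : EuclideanSpace ℝ (Fin n)) :
    ∑ i, ⟪fderiv ℝ (tiltedMean P) v (b i), b i⟫ = R ^ 2 - ‖tiltedMean P v‖ ^ 2 := by
  have hT := isProbabilityMeasure_tilted_inner hP v
  have hi : Integrable (fun x => (innerSL ℝ x).smulRight x) (P.tilted fun x => ⟪v, x⟫) :=
    integrable_tilted_inner hP continuous_smulRight_innerSL (C := R * R) (fun x hx => by
      rw [ContinuousLinearMap.norm_smulRight_apply, innerSL_apply_norm, hx]) v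
  have hi2 : ∀ i, Integrable (fun x : EuclideanSpace ℝ (Fin n) => ⟪x, b i⟫ • x)
      (P.tilted fun x => ⟪v, x⟫) := fun i => by
    simpa using hi.apply_continuousLinearMap (b i)
  have hi3 : ∀ i, Integrable (fun x : EuclideanSpace ℝ (Fin n) => ⟪b i, x⟫ ^ 2)
      (P.tilted fun x => ⟪v, x⟫) := fun i => by
    refine ((hi2 i).inner_const (b i)).congr (.of_forall fun x => ?_)
    simp only [inner_smul_left, real_inner_comm]
    simp [sq]
  have h1 : ∀ i, ⟪fderiv ℝ (tiltedMean P) v (b i), b i⟫ =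
      ∫ x, ⟪b i, x⟫ ^ 2 ∂(P.tilted fun x => ⟪v, x⟫) - ⟪b i, tiltedMean P v⟫ ^ 2 := fun i => by
    rw [(hasFDerivAt_tiltedMean hP v).fderiv, sub_apply, inner_sub_left,
      ContinuousLinearMap.integral_apply hi]
    simp only [ContinuousLinearMap.smulRight_apply, innerSL_apply_apply]
    rw [real_inner_comm, ← integral_inner (hi2 i)]
    congr 1
    · congr 1; ext x
      rw [inner_smul_right, real_inner_comm, sq]
    · rw [inner_smul_left, real_inner_comm, sq]; simp
  simp_rw [h1]
  rw [Finset.sum_sub_distrib, ← integral_finsetSum _ fun i _ => hi3 i, b.sum_sq_inner_right]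
  simp_rw [b.sum_sq_inner_right]
  congr 1
  rw [integral_congr_ae (g := fun _ => R ^ 2)]
  · simp
  · filter_upwards [ae_norm_eq_tilted_inner hP v] with x hx
    rw [hx]

end Tilted

/-! ### Gaussian integration by parts -/

section Stein

variable {n : ℕ}

theorem hasFDerivAt_noiseDensity (z : EuclideanSpace ℝ (Fin n)) :
    HasFDerivAt noiseDensity (-noiseDensity z • innerSL ℝ z) z := by
  have h := (((hasStrictFDerivAt_norm_sq z).hasFDerivAt.const_mul (-1 / 2 : ℝ)).exp).const_mul
    ((2 * Real.pi) ^ (-(n : ℝ) / 2))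
  refine (h.congr_of_eventuallyEq (.of_forall fun w => ?_)).congr_fderiv ?_
  · simp only [noiseDensity]
    ring_nf
  · ext w
    simp only [noiseDensity, smul_apply, smul_eq_mul, nsmul_eq_mul]
    ring_nf

/-- Stein's identity: integrate by parts against φ, using ∇φ(z) = -φ(z) z. -/
theorem integral_inner_mul_stdGaussian {u : EuclideanSpace ℝ (Fin n) → ℝ}
    (hu : Differentiable ℝ u) {C C' : ℝ} (hC : ∀ z, ‖u z‖ ≤ C) (hC' : ∀ z, ‖fderiv ℝ u z‖ ≤ C')
    (w : EuclideanSpace ℝ (Fin n)) :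
    ∫ z, ⟪z, w⟫ * u z ∂stdGaussian (EuclideanSpace ℝ (Fin n)) =
      ∫ z, fderiv ℝ u z w ∂stdGaussian (EuclideanSpace ℝ (Fin n)) := by
  have hiw : Integrable (fun z => ⟪z, w⟫ * u z) (stdGaussian (EuclideanSpace ℝ (Fin n))) :=
    (IsGaussian.integrable_id.inner_const w).mul_bdd (c := C)
      hu.continuous.aestronglyMeasurable (.of_forall hC)
  have hi' : Integrable (fun z => fderiv ℝ u z w) (stdGaussian (EuclideanSpace ℝ (Fin n))) :=
    .of_bound (measurable_fderiv_apply_const ℝ u w).aestronglyMeasurable (C' * ‖w‖)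
      (.of_forall fun z => ((fderiv ℝ u z).le_opNorm w).trans (by gcongr; exact hC' z))
  have hi : Integrable u (stdGaussian (EuclideanSpace ℝ (Fin n))) :=
    .of_bound hu.continuous.aestronglyMeasurable C (.of_forall hC)
  have key := integral_bilinear_hasFDerivAt_right_eq_neg_left_of_integrable
    (μ := (volume : Measure (EuclideanSpace ℝ (Fin n)))) (f := u) (f' := fderiv ℝ u)
    (g := noiseDensity) (g' := fun z => -noiseDensity z • innerSL ℝ z) (v := w)
    (B := ContinuousLinearMap.mul ℝ ℝ) ?_ ?_ ?_ (fun z _ => (hu z).hasFDerivAt)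
    (fun z _ => hasFDerivAt_noiseDensity z)
  · simp only [ContinuousLinearMap.mul_apply', smul_apply, innerSL_apply_apply, smul_eq_mul] at key
    rw [integral_stdGaussian, integral_stdGaussian]
    calc ∫ z, noiseDensity z • (⟪z, w⟫ * u z)
        = -∫ z, u z * (-noiseDensity z * ⟪z, w⟫) := by
          rw [← integral_neg]
          exact integral_congr_ae (.of_forall fun z => by simp only [smul_eq_mul]; ring)
      _ = ∫ z, noiseDensity z • fderiv ℝ u z w := by
          rw [key, neg_neg]
          exact integral_congr_ae (.of_forall fun z => by simp only [smul_eq_mul]; ring)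
  · refine (integrable_stdGaussian_iff.1 hi').congr (.of_forall fun z => ?_)
    simp [mul_comm]
  · refine (integrable_stdGaussian_iff.1 hiw.neg).congr (.of_forall fun z => ?_)
    simp only [ContinuousLinearMap.mul_apply', smul_apply, innerSL_apply_apply, smul_eq_mul,
      Pi.neg_apply]
    ring
  · refine (integrable_stdGaussian_iff.1 hi).congr (.of_forall fun z => ?_)
    simp [mul_comm]

theorem integral_inner_stdGaussian {F : EuclideanSpace ℝ (Fin n) → EuclideanSpace ℝ (Fin n)}
    (hF : Differentiable ℝ F) {C C' : ℝ} (hC : ∀ z, ‖F z‖ ≤ C) (hC' : ∀ z, ‖fderiv ℝ F z‖ ≤ C')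
    {ι : Type*} [Fintype ι] (b : OrthonormalBasis ι ℝ (EuclideanSpace ℝ (Fin n))) :
    ∫ z, ⟪z, F z⟫ ∂stdGaussian (EuclideanSpace ℝ (Fin n)) =
      ∫ z, ∑ i, ⟪fderiv ℝ F z (b i), b i⟫ ∂stdGaussian (EuclideanSpace ℝ (Fin n)) := by
  have hd : ∀ i z, HasFDerivAt (fun z => ⟪b i, F z⟫) ((innerSL ℝ (b i)).comp (fderiv ℝ F z)) z :=
    fun i z => (innerSL ℝ (b i)).hasFDerivAt.comp z (hF z).hasFDerivAt
  have hb : ∀ i z, ‖⟪b i, F z⟫‖ ≤ C := fun i z =>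
    (norm_inner_le_norm _ _).trans (by simpa using hC z)
  have hb' : ∀ i z, ‖fderiv ℝ (fun z => ⟪b i, F z⟫) z‖ ≤ C' := fun i z => by
    rw [(hd i z).fderiv]
    refine (ContinuousLinearMap.opNorm_comp_le _ _).trans ?_
    simpa [innerSL_apply_norm] using hC' z
  have hdu : ∀ i, Differentiable ℝ (fun z => ⟪b i, F z⟫) := fun i z => (hd i z).differentiableAt
  have he : ∀ i z, fderiv ℝ (fun z => ⟪b i, F z⟫) z (b i) = ⟪fderiv ℝ F z (b i), b i⟫ := fun i z => by
    rw [(hd i z).fderiv, real_inner_comm]; rfl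
  simp_rw [fun z => (b.sum_inner_mul_inner z (F z)).symm, ← he]
  rw [integral_finsetSum, integral_finsetSum]
  · exact Finset.sum_congr rfl fun i _ =>
      integral_inner_mul_stdGaussian (hdu i) (hb i) (hb' i) (b i)
  · exact fun i _ => .of_bound (measurable_fderiv_apply_const ℝ _ _).aestronglyMeasurable C'
      (.of_forall fun z => ((fderiv ℝ _ z).le_opNorm _).trans (by simpa using hb' i z))
  · exact fun i _ => (IsGaussian.integrable_id.inner_const (b i)).mul_bdd (c := C)
      (hdu i).continuous.aestronglyMeasurable (.of_forall (hb i))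

end Stein

/-! ### The derivative along the signal-to-noise ratio -/

section Interpolation

variable {n : ℕ} {P : Measure (EuclideanSpace ℝ (Fin n))} {R : ℝ}

/-- The mean of `‖x - E[X | Y_γ]‖²` given `X = x`, for an input law `P` on a sphere, where
`E[X | Y_γ = y] = tiltedMean P (√γ y)`. -/
noncomputable def tiltedMSE (P : Measure (EuclideanSpace ℝ (Fin n))) (γ : ℝ)
    (x : EuclideanSpace ℝ (Fin n)) : ℝ :=
  ∫ z, ‖x - tiltedMean P (γ • x + Real.sqrt γ • z)‖ ^ 2 ∂stdGaussian (EuclideanSpace ℝ (Fin n))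

/-- log G vanishes at 0 and its gradient, the tilted mean, has norm at most `R`. -/
theorem abs_log_expMoment_le [IsProbabilityMeasure P] (hP : ∀ᵐ x ∂P, ‖x‖ = R)
    (v : EuclideanSpace ℝ (Fin n)) : |Real.log (expMoment P v)| ≤ R * ‖v‖ := by
  have h := convex_univ.norm_image_sub_le_of_norm_hasFDerivWithin_le (𝕜 := ℝ) (C := R)
    (fun w _ => (hasFDerivAt_log_expMoment hP w).hasFDerivWithinAt)
    (fun w _ => by rw [innerSL_apply_norm]; exact norm_tiltedMean_le hP w)
    (Set.mem_univ 0) (Set.mem_univ v)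
  simpa [expMoment] using h

theorem continuous_log_expMoment [IsProbabilityMeasure P] (hP : ∀ᵐ x ∂P, ‖x‖ = R) :
    Continuous fun v => Real.log (expMoment P v) :=
  continuous_iff_continuousAt.2 fun v => (hasFDerivAt_log_expMoment hP v).continuousAt

theorem continuous_tiltedMSE [IsProbabilityMeasure P] (hP : ∀ᵐ x ∂P, ‖x‖ = R)
    (x : EuclideanSpace ℝ (Fin n)) : Continuous fun γ => tiltedMSE P γ x := by
  have hc := (differentiable_tiltedMean hP).continuous
  refine continuous_of_dominated (bound := fun _ => (‖x‖ + R) ^ 2) (fun γ => by fun_prop)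
    (fun γ => .of_forall fun z => ?_) (integrable_const _) (.of_forall fun z => by fun_prop)
  rw [norm_pow, norm_norm]
  gcongr
  exact (norm_sub_le _ _).trans (by gcongr; exact norm_tiltedMean_le hP _)

theorem tiltedMSE_eq [IsProbabilityMeasure P] (hP : ∀ᵐ x ∂P, ‖x‖ = R)
    (γ : ℝ) (x : EuclideanSpace ℝ (Fin n)) :
    tiltedMSE P γ x = ‖x‖ ^ 2 -
      2 * ∫ z, ⟪x, tiltedMean P (γ • x + Real.sqrt γ • z)⟫ ∂stdGaussian (EuclideanSpace ℝ (Fin n)) +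
      ∫ z, ‖tiltedMean P (γ • x + Real.sqrt γ • z)‖ ^ 2 ∂stdGaussian (EuclideanSpace ℝ (Fin n)) := by
  have hc := (differentiable_tiltedMean hP).continuous
  have hb := norm_tiltedMean_le hP
  have h1 : Integrable (fun z => ⟪x, tiltedMean P (γ • x + Real.sqrt γ • z)⟫)
      (stdGaussian (EuclideanSpace ℝ (Fin n))) :=
    .of_bound (by fun_prop) (‖x‖ * R) (.of_forall fun z =>
      (norm_inner_le_norm _ _).trans (by gcongr; exact hb _))
  have h2 : Integrable (fun z => ‖tiltedMean P (γ • x + Real.sqrt γ • z)‖ ^ 2)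
      (stdGaussian (EuclideanSpace ℝ (Fin n))) :=
    .of_bound (by fun_prop) (R ^ 2) (.of_forall fun z => by
      rw [norm_pow, norm_norm]; gcongr; exact hb _)
  simp_rw [tiltedMSE, norm_sub_sq_real]
  have h3 : Integrable (fun z => ‖x‖ ^ 2 - 2 * ⟪x, tiltedMean P (γ • x + Real.sqrt γ • z)⟫)
      (stdGaussian (EuclideanSpace ℝ (Fin n))) := (integrable_const _).sub (h1.const_mul 2)
  rw [integral_add h3 h2,
    integral_sub (integrable_const _) (h1.const_mul 2), integral_const_mul]
  simp

/-- Stein's identity for the field z ↦ m(a + s z): the chain rule produces the factor `s`, and the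
divergence of m is the trace computed above. -/
theorem integral_inner_tiltedMean_stdGaussian [IsProbabilityMeasure P] (hP : ∀ᵐ x ∂P, ‖x‖ = R)
    (a : EuclideanSpace ℝ (Fin n)) (s : ℝ) :
    ∫ z, ⟪z, tiltedMean P (a + s • z)⟫ ∂stdGaussian (EuclideanSpace ℝ (Fin n)) =
      s * ∫ z, (R ^ 2 - ‖tiltedMean P (a + s • z)‖ ^ 2) ∂stdGaussian (EuclideanSpace ℝ (Fin n)) := by
  have hd : ∀ z, HasFDerivAt (fun z => tiltedMean P (a + s • z))
      (s • fderiv ℝ (tiltedMean P) (a + s • z)) z := fun z => by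
    have h1 : HasFDerivAt (fun z : EuclideanSpace ℝ (Fin n) => a + s • z)
        (s • ContinuousLinearMap.id ℝ _) z := ((hasFDerivAt_id z).const_smul s).const_add a
    refine ((differentiable_tiltedMean hP _).hasFDerivAt.comp z h1).congr_fderiv ?_
    ext1 w; simp
  rw [integral_inner_stdGaussian (fun z => (hd z).differentiableAt)
    (fun z => norm_tiltedMean_le hP _) (C' := ‖s‖ * (R * R + R * R))
    (fun z => by
      rw [(hd z).fderiv, norm_smul]
      gcongr
      exact norm_fderiv_tiltedMean_le hP _) (EuclideanSpace.basisFun (Fin n) ℝ),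
    ← integral_const_mul]
  congr 1
  ext z
  rw [← sum_inner_fderiv_tiltedMean hP (EuclideanSpace.basisFun (Fin n) ℝ), Finset.mul_sum]
  refine Finset.sum_congr rfl fun i _ => ?_
  rw [(hd z).fderiv, smul_apply, real_inner_smul_left]

theorem hasDerivAt_integral_log_expMoment [IsProbabilityMeasure P] (hP : ∀ᵐ x ∂P, ‖x‖ = R)
    (x : EuclideanSpace ℝ (Fin n)) {γ : ℝ} (hγ : 0 < γ) :
    HasDerivAt (fun γ => ∫ z, Real.log (expMoment P (γ • x + Real.sqrt γ • z))
        ∂stdGaussian (EuclideanSpace ℝ (Fin n)))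
      ((‖x‖ ^ 2 + R ^ 2 - tiltedMSE P γ x) / 2) γ := by
  have hc := (differentiable_tiltedMean hP).continuous
  have hg := continuous_log_expMoment hP
  have hb := norm_tiltedMean_le hP
  have hR : 0 ≤ R := (norm_nonneg _).trans (hb 0)
  have hint : ∀ γ : ℝ, Integrable (fun z => Real.log (expMoment P (γ • x + Real.sqrt γ • z)))
      (stdGaussian (EuclideanSpace ℝ (Fin n))) := fun γ => by
    refine Integrable.mono' (((integrable_const (|γ| * ‖x‖)).add
      (integrable_norm_stdGaussian.const_mul √γ)).const_mul R)
      (hg.comp (by fun_prop : Continuous fun z => γ • x + √γ • z)).aestronglyMeasurable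
      (.of_forall fun z => (abs_log_expMoment_le hP _).trans ?_)
    refine mul_le_mul_of_nonneg_left ((norm_add_le _ _).trans (le_of_eq ?_)) hR
    simp [norm_smul, abs_of_nonneg (Real.sqrt_nonneg γ)]
  -- Staying above `γ / 2` keeps the factor 1/(2√t) bounded.
  have h_bound : ∀ z, ∀ t ∈ Set.Ioi (γ / 2),
      ‖⟪tiltedMean P (t • x + √t • z), x + (1 / (2 * √t)) • z⟫‖ ≤
        R * (‖x‖ + 1 / (2 * √(γ / 2)) * ‖z‖) := by
    refine fun z t (ht : γ / 2 < t) => (norm_inner_le_norm _ _).trans ?_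
    have h0 : 0 < √(γ / 2) := Real.sqrt_pos.2 (by linarith)
    refine mul_le_mul (hb _) ((norm_add_le _ _).trans ?_) (norm_nonneg _) hR
    rw [norm_smul, Real.norm_of_nonneg (by positivity)]
    gcongr
  have h_diff : ∀ z, ∀ t ∈ Set.Ioi (γ / 2),
      HasDerivAt (fun t : ℝ => Real.log (expMoment P (t • x + √t • z)))
        ⟪tiltedMean P (t • x + √t • z), x + (1 / (2 * √t)) • z⟫ t := by
    intro z t (ht : γ / 2 < t)
    have ht0 : t ≠ 0 := by linarith
    have h1 : HasDerivAt (fun t : ℝ => t • x + √t • z) (x + (1 / (2 * √t)) • z) t := by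
      exact (((hasDerivAt_id' t).smul_const x).fun_add
        ((Real.hasDerivAt_sqrt ht0).smul_const z)).congr_deriv (by simp)
    exact (hasFDerivAt_log_expMoment hP (t • x + √t • z)).comp_hasDerivAt t h1
  obtain ⟨hi, hd⟩ := hasDerivAt_integral_of_dominated_loc_of_deriv_le
    (μ := stdGaussian (EuclideanSpace ℝ (Fin n))) (Ioi_mem_nhds (by linarith : γ / 2 < γ))
    (.of_forall fun γ => (hint γ).aestronglyMeasurable) (hint γ) (by fun_prop)
    (.of_forall h_bound)
    (((integrable_const _).add (integrable_norm_stdGaussian.const_mul _)).const_mul R)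
    (.of_forall h_diff)
  refine hd.congr_deriv ?_
  have h1 : Integrable (fun z => ⟪x, tiltedMean P (γ • x + Real.sqrt γ • z)⟫)
      (stdGaussian (EuclideanSpace ℝ (Fin n))) :=
    .of_bound (by fun_prop) (‖x‖ * R) (.of_forall fun z =>
      (norm_inner_le_norm _ _).trans (by gcongr; exact hb _))
  have h2 : Integrable (fun z => ‖tiltedMean P (γ • x + Real.sqrt γ • z)‖ ^ 2)
      (stdGaussian (EuclideanSpace ℝ (Fin n))) :=
    .of_bound (by fun_prop) (R ^ 2) (.of_forall fun z => by
      rw [norm_pow, norm_norm]; gcongr; exact hb _)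
  have h3 : Integrable (fun z => ⟪z, tiltedMean P (γ • x + Real.sqrt γ • z)⟫)
      (stdGaussian (EuclideanSpace ℝ (Fin n))) :=
    Integrable.mono' (integrable_norm_stdGaussian.mul_const R) (by fun_prop)
      (.of_forall fun z => (norm_inner_le_norm _ _).trans (by gcongr; exact hb _))
  have h4 : ∀ z, ⟪tiltedMean P (γ • x + Real.sqrt γ • z), x + (1 / (2 * √γ)) • z⟫ =
      ⟪x, tiltedMean P (γ • x + Real.sqrt γ • z)⟫ +
        1 / (2 * √γ) * ⟪z, tiltedMean P (γ • x + Real.sqrt γ • z)⟫ := fun z => by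
    rw [inner_add_right, inner_smul_right, real_inner_comm, real_inner_comm z]
  rw [integral_congr_ae (.of_forall h4)]
  rw [integral_add h1 (h3.const_mul _), integral_const_mul,
    integral_inner_tiltedMean_stdGaussian hP, integral_sub (integrable_const _) h2,
    tiltedMSE_eq hP]
  have := Real.sqrt_pos.2 hγ
  simp only [integral_const, probReal_univ, one_smul]
  -- The factor √γ from Stein's identity cancels the 1/(2√γ) from the derivative of the square root.
  field_simp
  ring

theorem integral_tiltedMSE [IsProbabilityMeasure P] (hP : ∀ᵐ x ∂P, ‖x‖ = R)
    (x : EuclideanSpace ℝ (Fin n)) :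
    (1 / 2) * ∫ γ in (0 : ℝ)..1, tiltedMSE P γ x = (‖x‖ ^ 2 + R ^ 2) / 2 -
      ∫ z, Real.log (expMoment P (x + z)) ∂stdGaussian (EuclideanSpace ℝ (Fin n)) := by
  have hg := continuous_log_expMoment hP
  have hR : 0 ≤ R := (norm_nonneg _).trans (norm_tiltedMean_le hP 0)
  have hM := continuous_tiltedMSE hP x
  -- The derivative is available only for γ > 0, so the endpoint 0 is reached by continuity.
  have hcont : ContinuousOn (fun γ => ∫ z, Real.log (expMoment P (γ • x + Real.sqrt γ • z))
      ∂stdGaussian (EuclideanSpace ℝ (Fin n))) (Set.Icc 0 1) := by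
    refine continuousOn_of_dominated (bound := fun z => R * (‖x‖ + ‖z‖))
      (fun γ _ => (hg.comp (by fun_prop : Continuous fun z => γ • x + √γ • z)).aestronglyMeasurable)
      (fun γ hγ => .of_forall fun z => (abs_log_expMoment_le hP _).trans ?_)
      (((integrable_const _).add integrable_norm_stdGaussian).const_mul R)
      (.of_forall fun z => (hg.comp
        (by fun_prop : Continuous fun γ : ℝ => γ • x + √γ • z)).continuousOn)
    refine mul_le_mul_of_nonneg_left ((norm_add_le _ _).trans ?_) hR
    rw [norm_smul, norm_smul, Real.norm_of_nonneg hγ.1, Real.norm_of_nonneg (Real.sqrt_nonneg _)]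
    gcongr
    · exact mul_le_of_le_one_left (norm_nonneg _) hγ.2
    · exact mul_le_of_le_one_left (norm_nonneg _) (Real.sqrt_le_one.2 hγ.2)
  have hftc := intervalIntegral.integral_eq_sub_of_hasDerivAt_of_le zero_le_one hcont
    (fun γ hγ => hasDerivAt_integral_log_expMoment hP x hγ.1)
    (Continuous.intervalIntegrable (by fun_prop) 0 1)
  rw [intervalIntegral.integral_div, intervalIntegral.integral_sub
    intervalIntegrable_const (hM.intervalIntegrable 0 1)] at hftc
  -- The boundary term at γ = 0 is log G(0) = log 1 = 0.
  simp [expMoment] at hftc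
  simp only [expMoment]
  linarith

end Interpolation

/-! ### The information density in terms of log G -/

section InfoDensity

variable {n : ℕ} {P : Measure (EuclideanSpace ℝ (Fin n))} {R : ℝ}

theorem noiseDensity_sub_smul (s : ℝ) (x y : EuclideanSpace ℝ (Fin n)) :
    noiseDensity (y - s • x) =
      noiseDensity y * Real.exp (-(s ^ 2 * ‖x‖ ^ 2) / 2) * Real.exp ⟪s • y, x⟫ := by
  simp only [noiseDensity]
  rw [mul_assoc, mul_assoc, ← Real.exp_add, ← Real.exp_add, norm_sub_sq_real, norm_smul,
    inner_smul_right, real_inner_smul_left, mul_pow, Real.norm_eq_abs, sq_abs]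
  ring_nf

theorem integral_noiseDensity_sub_smul (hP : ∀ᵐ x ∂P, ‖x‖ = R) (s : ℝ)
    (y : EuclideanSpace ℝ (Fin n)) :
    ∫ x, noiseDensity (y - s • x) ∂P =
      noiseDensity y * Real.exp (-(s ^ 2 * R ^ 2) / 2) * expMoment P (s • y) := by
  rw [expMoment, ← integral_const_mul]
  refine integral_congr_ae ?_
  filter_upwards [hP] with x hx
  rw [noiseDensity_sub_smul, hx]

/-- Bayes' rule: for constant ‖x‖ the likelihood of `x` given `y` is proportional to exp⟪s y, x⟫, so
the posterior is the law tilted by `s • y`. -/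
theorem integral_noiseDensity_sub_smul_smul_self [IsProbabilityMeasure P]
    (hP : ∀ᵐ x ∂P, ‖x‖ = R) (s : ℝ) (y : EuclideanSpace ℝ (Fin n)) :
    ∫ x, noiseDensity (y - s • x) • x ∂P =
      ∫ x, noiseDensity (y - s • x) • tiltedMean P (s • y) ∂P := by
  rw [integral_smul_const, integral_noiseDensity_sub_smul hP, tiltedMean, integral_tilted_inner,
    smul_smul, mul_assoc, mul_inv_cancel₀ (expMoment_pos hP _).ne', mul_one, ← integral_smul]
  refine integral_congr_ae ?_
  filter_upwards [hP] with x hx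
  rw [noiseDensity_sub_smul, hx, smul_smul]

theorem log_one_div_noiseDensity (z : EuclideanSpace ℝ (Fin n)) :
    Real.log (1 / noiseDensity z) =
      -Real.log ((2 * Real.pi) ^ (-(n : ℝ) / 2)) + ‖z‖ ^ 2 / 2 := by
  rw [one_div, Real.log_inv, noiseDensity, Real.log_mul (by positivity) (by positivity),
    Real.log_exp]
  ring

theorem integrable_log_one_div_noiseDensity :
    Integrable (fun z : EuclideanSpace ℝ (Fin n) => Real.log (1 / noiseDensity z))
      (stdGaussian (EuclideanSpace ℝ (Fin n))) := by
  simp_rw [log_one_div_noiseDensity]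
  exact (integrable_const _).add (integrable_norm_sq_stdGaussian.div_const 2)

theorem log_one_div_outputDensity_add [IsProbabilityMeasure P] (hP : ∀ᵐ x ∂P, ‖x‖ = R)
    (x z : EuclideanSpace ℝ (Fin n)) :
    Real.log (1 / outputDensity P (x + z)) =
      Real.log (1 / noiseDensity z) + ⟪x, z⟫ + (‖x‖ ^ 2 + R ^ 2) / 2 -
        Real.log (expMoment P (x + z)) := by
  have h := integral_noiseDensity_sub_smul hP 1 (x + z)
  simp only [one_smul] at h
  rw [outputDensity, h, one_div, Real.log_inv, Real.log_mul (by
    have := noiseDensity_pos (x + z); positivity) (expMoment_pos hP _).ne',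
    Real.log_mul (noiseDensity_pos _).ne' (by positivity), Real.log_exp,
    log_one_div_noiseDensity]
  have h1 := log_one_div_noiseDensity (x + z)
  rw [one_div, Real.log_inv, norm_add_sq_real] at h1
  linarith

theorem integrable_inner_stdGaussian (x : EuclideanSpace ℝ (Fin n)) :
    Integrable (fun z => ⟪x, z⟫) (stdGaussian (EuclideanSpace ℝ (Fin n))) :=
  IsGaussian.integrable_id.const_inner x

theorem integrable_log_expMoment_add [IsProbabilityMeasure P] (hP : ∀ᵐ x ∂P, ‖x‖ = R)
    (x : EuclideanSpace ℝ (Fin n)) :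
    Integrable (fun z => Real.log (expMoment P (x + z)))
      (stdGaussian (EuclideanSpace ℝ (Fin n))) := by
  have hR : 0 ≤ R := (norm_nonneg _).trans (norm_tiltedMean_le hP 0)
  exact Integrable.mono' (((integrable_const ‖x‖).add integrable_norm_stdGaussian).const_mul R)
    ((continuous_log_expMoment hP).comp (continuous_const.add continuous_id)).aestronglyMeasurable
    (.of_forall fun z => (abs_log_expMoment_le hP _).trans
      (mul_le_mul_of_nonneg_left (norm_add_le _ _) hR))

theorem integrable_log_one_div_outputDensity_add [IsProbabilityMeasure P]
    (hP : ∀ᵐ x ∂P, ‖x‖ = R) (x : EuclideanSpace ℝ (Fin n)) :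
    Integrable (fun z => Real.log (1 / outputDensity P (x + z)))
      (stdGaussian (EuclideanSpace ℝ (Fin n))) := by
  simp_rw [log_one_div_outputDensity_add hP]
  exact ((integrable_log_one_div_noiseDensity.add (integrable_inner_stdGaussian x)).add
    (integrable_const _)).sub (integrable_log_expMoment_add hP x)

theorem integrable_noiseDensity_mul_log_outputDensity [IsProbabilityMeasure P]
    (hP : ∀ᵐ x ∂P, ‖x‖ = R) (x : EuclideanSpace ℝ (Fin n)) :
    Integrable (fun y => noiseDensity (y - x) * Real.log (1 / outputDensity P y)) := by
  have h := (integrable_stdGaussian_iff.1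
    (integrable_log_one_div_outputDensity_add hP x)).comp_sub_right x
  simpa using h

theorem infoDensity_eq [IsProbabilityMeasure P] (hP : ∀ᵐ x ∂P, ‖x‖ = R)
    (x : EuclideanSpace ℝ (Fin n)) :
    infoDensity x P = (‖x‖ ^ 2 + R ^ 2) / 2 -
      ∫ z, Real.log (expMoment P (x + z)) ∂stdGaussian (EuclideanSpace ℝ (Fin n)) := by
  have h1 : ∫ y, noiseDensity (y - x) * Real.log (1 / outputDensity P y) =
      ∫ z, Real.log (1 / outputDensity P (x + z)) ∂stdGaussian (EuclideanSpace ℝ (Fin n)) := by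
    rw [integral_stdGaussian, ← integral_sub_right_eq_self
      (fun z => noiseDensity z • Real.log (1 / outputDensity P (x + z))) x]
    simp
  have h2 : noiseEntropy n =
      ∫ z, Real.log (1 / noiseDensity z) ∂stdGaussian (EuclideanSpace ℝ (Fin n)) := by
    rw [integral_stdGaussian]; rfl
  have h3 : ∫ z, ⟪x, z⟫ ∂stdGaussian (EuclideanSpace ℝ (Fin n)) = 0 :=
    integral_strongDual_stdGaussian (innerSL ℝ x)
  have hi : Integrable (fun z => Real.log (1 / noiseDensity z) + ⟪x, z⟫)
      (stdGaussian (EuclideanSpace ℝ (Fin n))) :=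
    integrable_log_one_div_noiseDensity.add (integrable_inner_stdGaussian x)
  have hi' : Integrable (fun z => Real.log (1 / noiseDensity z) + ⟪x, z⟫ + (‖x‖ ^ 2 + R ^ 2) / 2)
      (stdGaussian (EuclideanSpace ℝ (Fin n))) := hi.add (integrable_const _)
  rw [infoDensity, h1, h2]
  simp_rw [log_one_div_outputDensity_add hP]
  rw [integral_sub hi' (integrable_log_expMoment_add hP x),
    integral_add hi (integrable_const _),
    integral_add integrable_log_one_div_noiseDensity (integrable_inner_stdGaussian x), h3]
  simp only [integral_const, probReal_univ, one_smul]
  ring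

theorem infoDensity_eq_integral_tiltedMSE [IsProbabilityMeasure P] (hP : ∀ᵐ x ∂P, ‖x‖ = R)
    (x : EuclideanSpace ℝ (Fin n)) :
    infoDensity x P = (1 / 2) * ∫ γ in (0 : ℝ)..1, tiltedMSE P γ x := by
  rw [infoDensity_eq hP, integral_tiltedMSE hP]

end InfoDensity

/-! ### Equivariance under isometries -/

section Rotation

variable {n : ℕ} {P : Measure (EuclideanSpace ℝ (Fin n))} {R : ℝ}

theorem tiltedMean_map (U : EuclideanSpace ℝ (Fin n) ≃ₗᵢ[ℝ] EuclideanSpace ℝ (Fin n))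
    (hU : P.map U = P) (v : EuclideanSpace ℝ (Fin n)) :
    tiltedMean P (U v) = U (tiltedMean P v) := by
  have h1 : expMoment P (U v) = expMoment P v := by
    rw [expMoment, expMoment]
    conv_lhs => rw [← hU]
    refine (integral_map_equiv U.toMeasurableEquiv _).trans (integral_congr_ae (.of_forall fun x => ?_))
    simp [U.inner_map_map]
  have h2 : ∫ x, Real.exp ⟪U v, x⟫ • x ∂P = U (∫ x, Real.exp ⟪v, x⟫ • x ∂P) := by
    conv_lhs => rw [← hU]
    refine (integral_map_equiv U.toMeasurableEquiv _).trans
      (Eq.trans (integral_congr_ae (.of_forall fun x => ?_))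
        (U.toContinuousLinearEquiv.integral_comp_comm _))
    simp [U.inner_map_map]
  rw [tiltedMean, tiltedMean, integral_tilted_inner, integral_tilted_inner, h1, map_smul, h2]

theorem tiltedMSE_map (U : EuclideanSpace ℝ (Fin n) ≃ₗᵢ[ℝ] EuclideanSpace ℝ (Fin n))
    (hU : P.map U = P) (γ : ℝ) (x : EuclideanSpace ℝ (Fin n)) :
    tiltedMSE P γ (U x) = tiltedMSE P γ x := by
  have h := stdGaussian_map U
  rw [tiltedMSE]
  conv_lhs => rw [← h]
  refine (integral_map_equiv U.toMeasurableEquiv _).trans (integral_congr_ae (.of_forall fun z => ?_))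
  simp only [LinearIsometryEquiv.coe_toMeasurableEquiv]
  rw [← map_smul, ← map_smul, ← map_add, tiltedMean_map U hU, ← map_sub, U.norm_map]

/-- A reflection exchanges two points of equal norm, and it preserves the uniform law. -/
theorem tiltedMSE_sphereUniform_eq_of_norm_eq (R γ : ℝ) {x y : EuclideanSpace ℝ (Fin n)}
    (h : ‖x‖ = ‖y‖) : tiltedMSE (sphereUniform n R) γ x = tiltedMSE (sphereUniform n R) γ y := by
  rw [← Submodule.reflection_sub h]
  exact (tiltedMSE_map _ (map_sphereUniform _ R) γ x).symm

end Rotation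

/-! ### Identification of the conditional mean and of the conditional errors -/

section CondMean

variable {n : ℕ} {P : Measure (EuclideanSpace ℝ (Fin n))} {R : ℝ}
  {Ω : Type*} [MeasurableSpace Ω] {μ : Measure Ω} [IsProbabilityMeasure μ]
  {X Z : Ω → EuclideanSpace ℝ (Fin n)}

theorem measurable_snrOutput (hXm : Measurable X) (hZm : Measurable Z) (γ : ℝ) :
    Measurable (snrOutput X Z γ) := by
  unfold snrOutput; fun_prop

theorem map_prodMk_eq (hXm : Measurable X) (hZm : Measurable Z) (hX : μ.map X = P)
    (hZ : μ.map Z = stdGaussian (EuclideanSpace ℝ (Fin n))) (hXZ : IndepFun X Z μ) :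
    μ.map (fun ω => (X ω, Z ω)) = P.prod (stdGaussian (EuclideanSpace ℝ (Fin n))) := by
  rw [(indepFun_iff_map_prod_eq_prod_map_map hXm.aemeasurable hZm.aemeasurable).1 hXZ, hX, hZ]

theorem integral_input_output [IsProbabilityMeasure P] (hXm : Measurable X) (hZm : Measurable Z)
    (hX : μ.map X = P) (hZ : μ.map Z = stdGaussian (EuclideanSpace ℝ (Fin n)))
    (hXZ : IndepFun X Z μ) (γ : ℝ) {F : Type*} [NormedAddCommGroup F] [NormedSpace ℝ F]
    {h : EuclideanSpace ℝ (Fin n) × EuclideanSpace ℝ (Fin n) → F} (hh : StronglyMeasurable h)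
    {C : ℝ} (hP : ∀ᵐ x ∂P, ∀ y, ‖h (x, y)‖ ≤ C) :
    ∫ ω, h (X ω, snrOutput X Z γ ω) ∂μ =
      ∫ x, ∫ z, h (x, √γ • x + z) ∂stdGaussian (EuclideanSpace ℝ (Fin n)) ∂P := by
  have hmap := map_prodMk_eq hXm hZm hX hZ hXZ
  have hs : StronglyMeasurable
      (fun p : EuclideanSpace ℝ (Fin n) × EuclideanSpace ℝ (Fin n) => h (p.1, √γ • p.1 + p.2)) :=
    hh.comp_measurable (by fun_prop)
  have h1 : ∫ ω, h (X ω, snrOutput X Z γ ω) ∂μ =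
      ∫ p, h (p.1, √γ • p.1 + p.2) ∂(P.prod (stdGaussian (EuclideanSpace ℝ (Fin n)))) := by
    rw [← hmap, integral_map (by fun_prop) hs.aestronglyMeasurable]
    rfl
  rw [h1, integral_prod]
  refine .of_bound hs.aestronglyMeasurable C ?_
  filter_upwards [Measure.quasiMeasurePreserving_fst.ae hP] with p hp using hp _

/-- Fubini for the joint density, with the output integrated last. The bound is asked only for
almost every input because it is applied to `h (x, y) = x`, bounded on the sphere alone. -/
theorem integral_input_output_swap [IsProbabilityMeasure P] (hXm : Measurable X)
    (hZm : Measurable Z) (hX : μ.map X = P)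
    (hZ : μ.map Z = stdGaussian (EuclideanSpace ℝ (Fin n)))
    (hXZ : IndepFun X Z μ) (γ : ℝ) {F : Type*} [NormedAddCommGroup F] [NormedSpace ℝ F]
    {h : EuclideanSpace ℝ (Fin n) × EuclideanSpace ℝ (Fin n) → F} (hh : StronglyMeasurable h)
    {C : ℝ} (hP : ∀ᵐ x ∂P, ∀ y, ‖h (x, y)‖ ≤ C) :
    ∫ ω, h (X ω, snrOutput X Z γ ω) ∂μ =
      ∫ y, ∫ x, noiseDensity (y - √γ • x) • h (x, y) ∂P := by
  have hm : StronglyMeasurable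
      (fun p : EuclideanSpace ℝ (Fin n) × EuclideanSpace ℝ (Fin n) =>
        noiseDensity (p.2 - √γ • p.1) • h (p.1, p.2)) :=
    (Continuous.stronglyMeasurable (by fun_prop)).smul hh
  have hφ : ∀ a : EuclideanSpace ℝ (Fin n), Integrable (fun y => noiseDensity (y - a)) := fun a =>
    integrable_noiseDensity.comp_sub_right a
  have hsec : ∀ᵐ x ∂P, Integrable (fun y => noiseDensity (y - √γ • x) • h (x, y)) := by
    filter_upwards [hP] with x hx
    refine ((hφ (√γ • x)).mul_const C).mono'
      (hm.comp_measurable measurable_prodMk_left).aestronglyMeasurable (.of_forall fun y => ?_)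
    rw [norm_smul, Real.norm_of_nonneg (noiseDensity_pos _).le]
    exact mul_le_mul_of_nonneg_left (hx y) (noiseDensity_pos _).le
  have hint : Integrable (fun p : EuclideanSpace ℝ (Fin n) × EuclideanSpace ℝ (Fin n) =>
      noiseDensity (p.2 - √γ • p.1) • h (p.1, p.2)) (P.prod volume) := by
    refine (integrable_prod_iff hm.aestronglyMeasurable).2 ⟨hsec, ?_⟩
    refine .of_bound hm.norm.integral_prod_right'.aestronglyMeasurable
      ((∫ y : EuclideanSpace ℝ (Fin n), noiseDensity y) * C) ?_
    filter_upwards [hP, hsec] with x hx hi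
    rw [Real.norm_of_nonneg (integral_nonneg fun _ => norm_nonneg _), ← integral_mul_const,
      ← integral_sub_right_eq_self (fun y => noiseDensity y * C) (√γ • x)]
    refine integral_mono hi.norm ((hφ (√γ • x)).mul_const C) fun y => ?_
    simp only [norm_smul, Real.norm_of_nonneg (noiseDensity_pos _).le]
    exact mul_le_mul_of_nonneg_left (hx y) (noiseDensity_pos _).le
  rw [integral_input_output hXm hZm hX hZ hXZ γ hh hP,
    ← integral_integral_swap (f := fun x y => noiseDensity (y - √γ • x) • h (x, y)) hint]
  congr 1
  ext1 x
  rw [integral_stdGaussian,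
    ← integral_sub_right_eq_self (fun z => noiseDensity z • h (x, √γ • x + z)) (√γ • x)]
  simp

/-- The candidate m(√γ Y_γ) is a function of the output and, by Bayes' rule under the outer integral
in y, has the same integral as X over every event {Y_γ ∈ t}. -/
theorem condMean_snrOutput_comp_ae_eq [IsProbabilityMeasure P] (hP : ∀ᵐ x ∂P, ‖x‖ = R)
    (hXm : Measurable X) (hZm : Measurable Z) (hX : μ.map X = P)
    (hZ : μ.map Z = stdGaussian (EuclideanSpace ℝ (Fin n))) (hXZ : IndepFun X Z μ) (γ : ℝ) :
    ∀ᵐ ω ∂μ, condMean μ X (snrOutput X Z γ) (snrOutput X Z γ ω) =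
      tiltedMean P (√γ • snrOutput X Z γ ω) := by
  have hY := measurable_snrOutput hXm hZm γ
  have hc := (differentiable_tiltedMean hP).continuous
  have hXn : ∀ᵐ ω ∂μ, ‖X ω‖ = R := ae_of_ae_map hXm.aemeasurable (hX ▸ hP)
  have hXi : Integrable X μ :=
    .of_bound hXm.aestronglyMeasurable R (hXn.mono fun _ h => h.le)
  have hT : Measurable fun ω => tiltedMean P (√γ • snrOutput X Z γ ω) :=
    (hc.measurable.comp (measurable_const_smul √γ)).comp hY
  have hTi : Integrable (fun ω => tiltedMean P (√γ • snrOutput X Z γ ω)) μ :=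
    .of_bound hT.aestronglyMeasurable R (.of_forall fun _ => norm_tiltedMean_le hP _)
  refine (condMean_comp_ae_eq μ X _ hXi hY).symm.trans
    (ae_eq_condExp_of_forall_setIntegral_eq hY.comap_le hXi (fun _ _ _ => hTi.integrableOn)
      ?_ ?_).symm
  · rintro _ ⟨t, ht, rfl⟩ -
    have hpre : MeasurableSet (Prod.snd ⁻¹' t :
        Set (EuclideanSpace ℝ (Fin n) × EuclideanSpace ℝ (Fin n))) := measurable_snd ht
    have e1 := integral_input_output_swap hXm hZm hX hZ hXZ γ
      (h := (Prod.snd ⁻¹' t).indicator fun p => tiltedMean P (√γ • p.2))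
      ((Continuous.stronglyMeasurable (by fun_prop)).indicator hpre) (C := R)
      (.of_forall fun x y => (norm_indicator_le_norm_self _ _).trans (norm_tiltedMean_le hP _))
    have e2 := integral_input_output_swap hXm hZm hX hZ hXZ γ
      (h := (Prod.snd ⁻¹' t).indicator fun p => p.1)
      ((Continuous.stronglyMeasurable (by fun_prop)).indicator hpre) (C := R)
      (hP.mono fun x hx y => (norm_indicator_le_norm_self _ _).trans hx.le)
    rw [← integral_indicator (hY ht), ← integral_indicator (hY ht)]
    refine e1.trans (Eq.trans ?_ e2.symm)
    congr 1
    ext1 y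
    by_cases hy : y ∈ t
    · simp [Set.indicator, hy, integral_noiseDensity_sub_smul_smul_self hP]
    · simp [Set.indicator, hy]
  · exact ((hc.measurable.comp (measurable_const_smul √γ)).comp
      (comap_measurable _)).stronglyMeasurable.aestronglyMeasurable

/-- A null set for Y_γ is, for some input x, null for a translate of the Gaussian, hence
Lebesgue-null. This transfers the formula for the conditional mean to the output law at input 0,
which lies off the support. -/
theorem volume_absolutelyContinuous_map_snrOutput [IsProbabilityMeasure P] (hXm : Measurable X)
    (hZm : Measurable Z) (hX : μ.map X = P)
    (hZ : μ.map Z = stdGaussian (EuclideanSpace ℝ (Fin n))) (hXZ : IndepFun X Z μ) (γ : ℝ) :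
    volume ≪ μ.map (snrOutput X Z γ) := by
  refine .mk fun s hs h0 => ?_
  have hf : Measurable (fun p : EuclideanSpace ℝ (Fin n) × EuclideanSpace ℝ (Fin n) =>
    √γ • p.1 + p.2) := by fun_prop
  have h1 : μ.map (snrOutput X Z γ) =
      (P.prod (stdGaussian (EuclideanSpace ℝ (Fin n)))).map fun p => √γ • p.1 + p.2 := by
    rw [← map_prodMk_eq hXm hZm hX hZ hXZ, Measure.map_map hf (by fun_prop)]
    rfl
  rw [h1, Measure.map_apply hf hs, Measure.measure_prod_null (hf hs)] at h0
  obtain ⟨x, hx⟩ := h0.exists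
  have h2 := absolutelyContinuous_stdGaussian hx
  have h3 := measure_preimage_add (volume : Measure (EuclideanSpace ℝ (Fin n))) (√γ • x) s
  rw [← h3]
  exact h2

theorem condMean_snrOutput_ae_eq [IsProbabilityMeasure P] (hP : ∀ᵐ x ∂P, ‖x‖ = R)
    (hXm : Measurable X) (hZm : Measurable Z) (hX : μ.map X = P)
    (hZ : μ.map Z = stdGaussian (EuclideanSpace ℝ (Fin n))) (hXZ : IndepFun X Z μ) (γ : ℝ) :
    ∀ᵐ y, condMean μ X (snrOutput X Z γ) y = tiltedMean P (√γ • y) := by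
  have hc := (differentiable_tiltedMean hP).continuous
  have hcm : Measurable (condMean μ X (snrOutput X Z γ)) :=
    (StronglyMeasurable.integral_condDistrib
      (f := fun p : EuclideanSpace ℝ (Fin n) × EuclideanSpace ℝ (Fin n) => p.2)
      (Continuous.stronglyMeasurable (by fun_prop))).measurable
  refine (volume_absolutelyContinuous_map_snrOutput hXm hZm hX hZ hXZ γ).ae_le ?_
  refine (ae_map_iff (measurable_snrOutput hXm hZm γ).aemeasurable
    (measurableSet_eq_fun hcm (by fun_prop))).2 ?_
  exact condMean_snrOutput_comp_ae_eq hP hXm hZm hX hZ hXZ γ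

theorem cond_eq_self {s : Set Ω} (h : ∀ᵐ ω ∂μ, ω ∈ s) : μ[|s] = μ := by
  rw [ProbabilityTheory.cond, Measure.restrict_eq_self_of_ae_mem h,
    (measure_congr (Filter.eventuallyEq_univ.2 h) : μ s = μ Set.univ)]
  simp

theorem sqError_snrOutput_ae_eq [IsProbabilityMeasure P] (hP : ∀ᵐ x ∂P, ‖x‖ = R)
    (hXm : Measurable X) (hZm : Measurable Z) (hX : μ.map X = P)
    (hZ : μ.map Z = stdGaussian (EuclideanSpace ℝ (Fin n))) (hXZ : IndepFun X Z μ) (γ : ℝ) :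
    (fun ω => sqError μ X Z γ (X ω) (snrOutput X Z γ ω)) =ᵐ[μ]
      fun ω => ‖X ω - tiltedMean P (√γ • snrOutput X Z γ ω)‖ ^ 2 := by
  filter_upwards [condMean_snrOutput_comp_ae_eq hP hXm hZm hX hZ hXZ γ] with ω hω
  rw [sqError, hω]

theorem norm_sub_tiltedMean_sq_le [IsProbabilityMeasure P] (hP : ∀ᵐ x ∂P, ‖x‖ = R)
    {x : EuclideanSpace ℝ (Fin n)} {r : ℝ} (hx : ‖x‖ = r) (v : EuclideanSpace ℝ (Fin n)) :
    ‖‖x - tiltedMean P v‖ ^ 2‖ ≤ (r + R) ^ 2 := by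
  rw [norm_pow, norm_norm]
  gcongr
  exact (norm_sub_le _ _).trans (add_le_add hx.le (norm_tiltedMean_le hP _))

theorem integrable_sqError_snrOutput [IsProbabilityMeasure P] (hP : ∀ᵐ x ∂P, ‖x‖ = R)
    (hXm : Measurable X) (hZm : Measurable Z) (hX : μ.map X = P)
    (hZ : μ.map Z = stdGaussian (EuclideanSpace ℝ (Fin n))) (hXZ : IndepFun X Z μ) (γ : ℝ) :
    Integrable (fun ω => sqError μ X Z γ (X ω) (snrOutput X Z γ ω)) μ := by
  rw [integrable_congr (sqError_snrOutput_ae_eq hP hXm hZm hX hZ hXZ γ)]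
  have hXn : ∀ᵐ ω ∂μ, ‖X ω‖ = R := ae_of_ae_map hXm.aemeasurable (hX ▸ hP)
  have hY := measurable_snrOutput hXm hZm γ
  have hc := (differentiable_tiltedMean hP).continuous.measurable
  exact .of_bound (Measurable.aestronglyMeasurable (by fun_prop)) ((R + R) ^ 2)
    (hXn.mono fun ω hω => norm_sub_tiltedMean_sq_le hP hω _)

theorem integral_sqError_snrOutput [IsProbabilityMeasure P] (hP : ∀ᵐ x ∂P, ‖x‖ = R)
    (hXm : Measurable X) (hZm : Measurable Z) (hX : μ.map X = P)
    (hZ : μ.map Z = stdGaussian (EuclideanSpace ℝ (Fin n))) (hXZ : IndepFun X Z μ)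
    {γ : ℝ} (hγ : 0 ≤ γ) :
    ∫ ω, sqError μ X Z γ (X ω) (snrOutput X Z γ ω) ∂μ = ∫ x, tiltedMSE P γ x ∂P := by
  have hc := (differentiable_tiltedMean hP).continuous
  rw [integral_congr_ae (sqError_snrOutput_ae_eq hP hXm hZm hX hZ hXZ γ)]
  have h := integral_input_output hXm hZm hX hZ hXZ γ
    (h := fun p => ‖p.1 - tiltedMean P (√γ • p.2)‖ ^ 2)
    (Continuous.stronglyMeasurable (by fun_prop)) (C := (R + R) ^ 2)
    (hP.mono fun x hx y => norm_sub_tiltedMean_sq_le hP hx _)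
  refine h.trans ?_
  -- √γ (√γ x + z) = γ x + √γ z, the argument used in `tiltedMSE`.
  simp_rw [smul_add, smul_smul, Real.mul_self_sqrt hγ]
  rfl

theorem channelLaw_zero (γ : ℝ) :
    channelLaw γ (0 : EuclideanSpace ℝ (Fin n)) = stdGaussian (EuclideanSpace ℝ (Fin n)) := by
  simp [channelLaw]

theorem sqError_zero_ae_eq [IsProbabilityMeasure P] (hP : ∀ᵐ x ∂P, ‖x‖ = R)
    (hXm : Measurable X) (hZm : Measurable Z) (hX : μ.map X = P)
    (hZ : μ.map Z = stdGaussian (EuclideanSpace ℝ (Fin n))) (hXZ : IndepFun X Z μ) (γ : ℝ) :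
    (fun y => sqError μ X Z γ 0 y) =ᵐ[channelLaw γ 0]
      fun y => ‖0 - tiltedMean P (√γ • y)‖ ^ 2 := by
  rw [channelLaw_zero]
  refine stdGaussian_absolutelyContinuous.ae_le ?_
  filter_upwards [condMean_snrOutput_ae_eq hP hXm hZm hX hZ hXZ γ] with y hy
  rw [sqError, hy]

theorem integrable_sqError_zero [IsProbabilityMeasure P] (hP : ∀ᵐ x ∂P, ‖x‖ = R)
    (hXm : Measurable X) (hZm : Measurable Z) (hX : μ.map X = P)
    (hZ : μ.map Z = stdGaussian (EuclideanSpace ℝ (Fin n))) (hXZ : IndepFun X Z μ) (γ : ℝ) :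
    Integrable (fun y => sqError μ X Z γ 0 y) (channelLaw γ 0) := by
  have hc := (differentiable_tiltedMean hP).continuous
  rw [integrable_congr (sqError_zero_ae_eq hP hXm hZm hX hZ hXZ γ), channelLaw_zero]
  exact .of_bound (by fun_prop) ((0 + R) ^ 2)
    (.of_forall fun y => norm_sub_tiltedMean_sq_le hP norm_zero _)

theorem condMSEOfEq_zero [IsProbabilityMeasure P] (hP : ∀ᵐ x ∂P, ‖x‖ = R)
    (hXm : Measurable X) (hZm : Measurable Z) (hX : μ.map X = P)
    (hZ : μ.map Z = stdGaussian (EuclideanSpace ℝ (Fin n))) (hXZ : IndepFun X Z μ) (γ : ℝ) :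
    condMSEOfEq μ X Z 0 γ = tiltedMSE P γ 0 := by
  rw [condMSEOfEq, integral_congr_ae (sqError_zero_ae_eq hP hXm hZm hX hZ hXZ γ),
    channelLaw_zero, tiltedMSE]
  simp

end CondMean

/-! ### Convergence and the two identities -/

theorem mainTheorem4 (n : ℕ) (hn : 1 ≤ n) (R : ℝ) (hR : 0 < R)
    {Ω : Type*} [MeasurableSpace Ω] (μ : Measure Ω) [IsProbabilityMeasure μ]
    (X Z : Ω → EuclideanSpace ℝ (Fin n)) (hXm : Measurable X) (hZm : Measurable Z)
    (hX : μ.map X = sphereUniform n R)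
    (hZ : μ.map Z = stdGaussian (EuclideanSpace ℝ (Fin n)))
    (hXZ : IndepFun X Z μ) :
    -- all the integrals below converge
    (Integrable
      (fun z : EuclideanSpace ℝ (Fin n) => noiseDensity z * Real.log (1 / noiseDensity z)) ∧
    (∀ x : EuclideanSpace ℝ (Fin n), ‖x‖ = R ∨ x = 0 →
      Integrable (fun y => noiseDensity (y - x) *
        Real.log (1 / outputDensity (sphereUniform n R) y))) ∧
    (∀ γ ∈ Set.Icc (0 : ℝ) 1,
      Integrable (fun ω => sqError μ X Z γ (X ω) (snrOutput X Z γ ω)) (μ[|{ω | ‖X ω‖ = R}]) ∧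
      Integrable (fun y => sqError μ X Z γ 0 y) (channelLaw γ 0)) ∧
    IntervalIntegrable (fun γ => condMSEOfNormEq μ X Z R γ) volume 0 1 ∧
    IntervalIntegrable (fun γ => condMSEOfEq μ X Z 0 γ) volume 0 1) ∧
    -- the two identities
    (∀ x : EuclideanSpace ℝ (Fin n), ‖x‖ = R →
      infoDensity x (sphereUniform n R) =
        (1 / 2) * ∫ γ in (0 : ℝ)..1, condMSEOfNormEq μ X Z R γ) ∧
    infoDensity 0 (sphereUniform n R) =
      (1 / 2) * ∫ γ in (0 : ℝ)..1, condMSEOfEq μ X Z 0 γ := by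
  have hPprob := isProbabilityMeasure_sphereUniform hn R
  have hP := ae_norm_eq_sphereUniform (n := n) hR.le
  have hXn : ∀ᵐ ω ∂μ, ‖X ω‖ = R := ae_of_ae_map hXm.aemeasurable (hX ▸ hP)
  have hcond : μ[|{ω | ‖X ω‖ = R}] = μ := cond_eq_self hXn
  -- The conditioning event has full measure, so the left side averages `tiltedMSE` over the sphere,
  -- where it is constant.
  have hsphere : ∀ x : EuclideanSpace ℝ (Fin n), ‖x‖ = R → ∀ γ ∈ Set.uIcc (0 : ℝ) 1,
      condMSEOfNormEq μ X Z R γ = tiltedMSE (sphereUniform n R) γ x := fun x hx γ hγ => by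
    rw [Set.uIcc_of_le zero_le_one] at hγ
    rw [condMSEOfNormEq, hcond, integral_sqError_snrOutput hP hXm hZm hX hZ hXZ hγ.1,
      integral_congr_ae (hP.mono fun y hy =>
        tiltedMSE_sphereUniform_eq_of_norm_eq R γ (hy.trans hx.symm))]
    simp
  have hzero : condMSEOfEq μ X Z 0 = fun γ => tiltedMSE (sphereUniform n R) γ 0 :=
    funext fun γ => condMSEOfEq_zero hP hXm hZm hX hZ hXZ γ
  refine ⟨⟨integrable_stdGaussian_iff.1 integrable_log_one_div_noiseDensity,
    fun x _ => integrable_noiseDensity_mul_log_outputDensity hP x, fun γ _ => ⟨?_,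
      integrable_sqError_zero hP hXm hZm hX hZ hXZ γ⟩, ?_, ?_⟩, fun x hx => ?_, ?_⟩
  · rw [hcond]
    exact integrable_sqError_snrOutput hP hXm hZm hX hZ hXZ γ
  · obtain ⟨x, hx⟩ := hP.exists
    exact ((continuous_tiltedMSE hP x).intervalIntegrable 0 1).congr fun γ hγ =>
      (hsphere x hx γ (Set.uIoc_subset_uIcc hγ)).symm
  · exact hzero ▸ (continuous_tiltedMSE hP 0).intervalIntegrable 0 1
  · rw [infoDensity_eq_integral_tiltedMSE hP, intervalIntegral.integral_congr (hsphere x hx)]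
  · rw [infoDensity_eq_integral_tiltedMSE hP, hzero]
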